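/- **Setting.** Let $\beta>1$, $I=\{1,\dots,N\}$, and $\Psi_i(x)=\beta^{-1}U_ix+\gamma_i$ ($i\in I$) be similitudes of $\mathbb R^d$ with $U_i$ orthogonal, satisfying the open set condition, and let $F$ be the non-empty compact set with $F=\bigcup_i\Psi_i(F)$. Let $a_i$ be the fixed point of $\Psi_i$ and $Fix=\{a_i:i\in I\}$. Let $V_0$ be the set of essential fixed points, i.e. of those $x\in Fix$ for which $\Psi_i(x)=\Psi_j(y)$ for some $i\ne j$ and $y\in Fix$; put $I_{Fix}=\{i\in I: a_i\in V_0\}$ and $\Psi_{i_1,\dots,i_n}=\Psi_{i_1}\circ\dots\circ\Psi_{i_n}$. Assume that $F$ is a uniform finitely ramified (u.f.r.) fractal: $F$ is connected, $|V_0|\ge 2$, and $\Psi_{w}(F)\cap\Psi_{w'}(F)=\Psi_{w}(V_0)\cap\Psi_{w'}(V_0)$ for distinct words $w,w'\in I^n$, $n\geq 1$. Assume also the normalisation $\Psi_1(x)=\beta^{-1}x$, $0\in V_0$. An $n$-cell is a set $\Psi_{i_1,\dots,i_n}(V_0)$, and $h_n(x,y)$ is the least $k\ge 1$ for which there are $n$-cells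 $K_1,\dots,K_k$ with $x\in K_1$, $y\in K_k$ and $K_i\cap K_{i+1}\neq\emptyset$ for $1\le i<k$. Let $\mathcal Q$ be the space of real symmetric matrices $(Q_{ij})_{i,j\in I_{Fix}}$ with zero row sums, $S_Q(\xi,\xi)=-\sum_{i,j}Q_{ij}\xi_i\xi_j$ for $\xi\in\mathbb R^{I_{Fix}}$, and let $\mathcal Q_M$ (resp. $\mathrm{Int}(\mathcal Q_M)$) be the set of $Q\in\mathcal Q$ with $Q_{ij}\ge 0$ (resp. $>0$) for $i\ne j$. Let $\Xi_+$ be the (countable, discrete) set of sequences $\eta=(\eta_k)_{k\ge1}$ in $I$ that are eventually equal to $1$, let $\eta\cdot k=(k,\eta_1,\eta_2,\dots)$, and let $\pi([\eta,i])=\lim_{n}\beta^n\Psi_{\eta_n}\circ\dots\circ\Psi_{\eta_1}(a_i)$; these points, for $\eta\in\Xi_+$ and $i\in I_{Fix}$, are the vertices of the unbounded graph $\hat V=\bigcup_n\beta^n\bigcup_{w\in I^n}\Psi_w(V_0)$. For $\theta:\Xi_+\to\mathcal Q_M$, the renormalised field $\bar\Phi(\theta):\Xi_+\to\mathcal Q_M$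 is given by tracing the network onto $\beta\hat V$ cell by cell: \[ S_{\bar\Phi(\theta)(\eta)}(\xi,\xi)=\inf\Big\{\sum_{k\in I}S_{\theta(\eta\cdot k)}\big(v(\pi([\eta\cdot k,\cdot])),v(\pi([\eta\cdot k,\cdot]))\big):\ v(\beta\,\pi([\eta,i]))=\xi_i\ \ \forall i\in I_{Fix}\Big\}. \] For a constant field $\theta\equiv Q$, $\bar\Phi(\theta)$ is again constant; call its value $\tilde\Phi(Q)$. Assume that $Q_0\in\mathrm{Int}(\mathcal Q_M)$ and $\varrho>0$ satisfy $\tilde\Phi(Q_0)=\varrho^{-1}Q_0$, and set $\Phi=\varrho\bar\Phi$, with $n$-th iterate $\Phi^n$. Let $\theta$ be a random family $(\theta(\eta))_{\eta\in\Xi_+}$ in $\mathcal Q_M$, defined on a probability space with measure $\mathbf P$, such that the $\theta(\eta)$ are independent and identically distributed and, for some constant $C_1>0$, almost surely $C_1S_{Q_0}(\xi,\xi)\le S_{\theta(\eta)}(\xi,\xi)$ for all $\eta$ and $\xi$. Suppose that the conductances have at most polynomial decay at infinity: there are $c_1>0$ and $\gamma_{ij}>0$ such that \[\mathbf P(\theta(\eta)_{ij}\ge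 s)\le c_1s^{-\gamma_{ij}}\qquad\text{for all } i\neq j\in I_{Fix},\ \eta\in\Xi_+,\ s\ge 1.\] **Proposition.** (a) If there exists $n_0\ge1$ such that $h_{n_0}(x,y)\ge 2$ for all distinct $x,y\in V_0$, then there exists $m\ge 1$ (possibly different from $n_0$) such that \[\mathbf E\big[(\Phi^{m}(\theta)(\eta)_{ij})^2\big]<\infty\qquad\text{for all } i,j\in I_{Fix},\ \eta\in\Xi_+.\] (b) In particular, the conclusion of (a) holds if $F$ is a nested fractal, i.e. a u.f.r. fractal such that any two $1$-cells are joined by a chain of successively intersecting $1$-cells, and such that for all distinct $x,y\in V_0$ and all $n\ge0$ the reflection in the hyperplane $\{z:|z-x|=|z-y|\}$ maps $n$-cells to $n$-cells. -/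

import Mathlib

open MeasureTheory ProbabilityTheory Filter
open scoped Classical

noncomputable section

/-- A finite family of similitudes `Ψ_i x = β⁻¹ U_i x + γ_i` of `ℝ^d` with a common contraction
ratio `β⁻¹ < 1` and orthogonal linear parts. The index set is `Fin N`, and the index `0 : Fin N`
plays the role of the distinguished first index. -/
structure SimilitudeSystem (d N : ℕ) where
  β : ℝ
  one_lt_β : 1 < β
  U : Fin N → (EuclideanSpace ℝ (Fin d) ≃ₗᵢ[ℝ] EuclideanSpace ℝ (Fin d))
  γ : Fin N → EuclideanSpace ℝ (Fin d)

namespace SimilitudeSystem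

variable {d N : ℕ} (S : SimilitudeSystem d N)

/-- The map `Ψ_i`. -/
def Ψ (i : Fin N) (x : EuclideanSpace ℝ (Fin d)) : EuclideanSpace ℝ (Fin d) :=
  S.β⁻¹ • S.U i x + S.γ i

theorem contractingWith_Ψ (i : Fin N) : ContractingWith (Real.toNNReal S.β⁻¹) (S.Ψ i) := by
  have hβ := S.one_lt_β
  have h0 : (0 : ℝ) ≤ S.β⁻¹ := by positivity
  constructor
  · rw [Real.toNNReal_lt_one]
    exact inv_lt_one_of_one_lt₀ hβ
  · refine LipschitzWith.of_dist_le_mul fun x y => ?_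
    simp only [Ψ, dist_add_right, dist_smul₀, (S.U i).dist_map, Real.coe_toNNReal _ h0,
      Real.norm_of_nonneg h0, le_refl]

/-- The fixed point `a_i` of `Ψ_i`. -/
def a (i : Fin N) : EuclideanSpace ℝ (Fin d) :=
  ContractingWith.fixedPoint (S.Ψ i) (S.contractingWith_Ψ i)

/-- The set `Fix` of the fixed points of the maps `Ψ_i`. -/
def Fix : Set (EuclideanSpace ℝ (Fin d)) := Set.range S.a

/-- The set `V_0` of essential fixed points. -/
def V₀ : Set (EuclideanSpace ℝ (Fin d)) :=
  {x | x ∈ S.Fix ∧ ∃ i j : Fin N, i ≠ j ∧ ∃ y ∈ S.Fix, S.Ψ i x = S.Ψ j y}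

/-- The index set `I_Fix` of those maps whose fixed point is essential. -/
def IFix : Type := {i : Fin N // S.a i ∈ S.V₀}

instance : Finite S.IFix := inferInstanceAs (Finite {i : Fin N // S.a i ∈ S.V₀})

instance : Fintype S.IFix := Fintype.ofFinite _

/-- The vector space `𝒬` of symmetric matrices indexed by `I_Fix` with vanishing row sums. -/
def IsQ (Q : S.IFix → S.IFix → ℝ) : Prop :=
  (∀ i j, Q i j = Q j i) ∧ ∀ i, ∑ j, Q i j = 0

/-- The quadratic form `S_Q(ξ, ξ) = -∑_{i,j} Q_{ij} ξ_i ξ_j` of `Q ∈ 𝒬`. -/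
def form (Q : S.IFix → S.IFix → ℝ) (ξ : S.IFix → ℝ) : ℝ :=
  -∑ i, ∑ j, Q i j * ξ i * ξ j

/-- The cone `𝒬_M` of the elements of `𝒬` with non-negative off-diagonal entries. -/
def IsQM (Q : S.IFix → S.IFix → ℝ) : Prop :=
  S.IsQ Q ∧ ∀ i j, i ≠ j → 0 ≤ Q i j

/-- The set `Int(𝒬_M)` of the elements of `𝒬` with positive off-diagonal entries. -/
def IsIntQM (Q : S.IFix → S.IFix → ℝ) : Prop :=
  S.IsQ Q ∧ ∀ i j, i ≠ j → 0 < Q i j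

/-- The composition `Ψ_{i_1} ∘ ⋯ ∘ Ψ_{i_n}` for a word `[i_1, …, i_n]`. -/
def word : List (Fin N) → EuclideanSpace ℝ (Fin d) → EuclideanSpace ℝ (Fin d)
  | [] => id
  | i :: w => S.Ψ i ∘ word w

/-- The `n`-cells: the sets `Ψ_{i_1, …, i_n}(V_0)`. -/
def IsCell (n : ℕ) (K : Set (EuclideanSpace ℝ (Fin d))) : Prop :=
  ∃ w : List (Fin N), w.length = n ∧ K = S.word w '' S.V₀

/-- `x` and `y` are joined by a chain `K_0, …, K_{k-1}` of `k ≥ 1` successively intersecting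
`n`-cells, with `x ∈ K_0` and `y ∈ K_{k-1}`. -/
def IsJoinedBy (n k : ℕ) (x y : EuclideanSpace ℝ (Fin d)) : Prop :=
  1 ≤ k ∧ ∃ K : ℕ → Set (EuclideanSpace ℝ (Fin d)),
    (∀ i < k, S.IsCell n (K i)) ∧ x ∈ K 0 ∧ y ∈ K (k - 1) ∧
      ∀ i, i + 1 < k → (K i ∩ K (i + 1)).Nonempty

/-- The cell-chain distance `h_n(x, y)`: the least number of `n`-cells in a chain that joins `x`
to `y` (and `⊤` if there is no chain). -/
def h (n : ℕ) (x y : EuclideanSpace ℝ (Fin d)) : ℕ∞ :=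
  ⨅ (k : ℕ) (_ : S.IsJoinedBy n k x y), (k : ℕ∞)

end SimilitudeSystem

/-- `F` is the compact uniform finitely ramified fractal determined by `S`, with the
normalisation `Ψ_1 x = β⁻¹ x` and `0 ∈ V_0`. The clauses on `F` before its connectedness say that
`F` is the (unique) self-similar compact set of the system. -/
structure IsUFRFractal {d N : ℕ} [NeZero N] (S : SimilitudeSystem d N)
    (F : Set (EuclideanSpace ℝ (Fin d))) : Prop where
  open_set_condition : ∃ W : Set (EuclideanSpace ℝ (Fin d)),
    W.Nonempty ∧ Bornology.IsBounded W ∧ IsOpen W ∧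
      (∀ i j, i ≠ j → Disjoint (S.Ψ i '' W) (S.Ψ j '' W)) ∧ (⋃ i, S.Ψ i '' W) ⊆ W
  nonempty : F.Nonempty
  isCompact : IsCompact F
  self_similar : F = ⋃ i, S.Ψ i '' F
  isConnected : IsConnected F
  finitely_ramified : ∀ w w' : List (Fin N), w.length = w'.length → w ≠ w' →
    S.word w '' F ∩ S.word w' '' F = S.word w '' S.V₀ ∩ S.word w' '' S.V₀
  nontrivial : S.V₀.Nontrivial
  Ψ_zero : ∀ x, S.Ψ 0 x = S.β⁻¹ • x
  zero_mem : (0 : EuclideanSpace ℝ (Fin d)) ∈ S.V₀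

instance {d : ℕ} (x y : EuclideanSpace ℝ (Fin d)) :
    Nonempty (AffineSubspace.perpBisector x y) :=
  AffineSubspace.perpBisector_nonempty.to_subtype

/-- A nested fractal: a uniform finitely ramified fractal (in particular the open set condition,
the nesting axiom and `|V_0| ≥ 2` hold) which satisfies the connectivity axiom and the symmetry
axiom: for distinct `x, y ∈ V_0`, the reflection in the hyperplane of the points equidistant from
`x` and `y` maps `n`-cells to `n`-cells. -/
structure IsNestedFractal {d N : ℕ} [NeZero N] (S : SimilitudeSystem d N)
    (F : Set (EuclideanSpace ℝ (Fin d))) : Prop extends IsUFRFractal S F where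
  connectivity : ∀ K K' : Set (EuclideanSpace ℝ (Fin d)), S.IsCell 1 K → S.IsCell 1 K' →
    Relation.ReflTransGen (fun A B => S.IsCell 1 A ∧ S.IsCell 1 B ∧ (A ∩ B).Nonempty) K K'
  symmetry : ∀ x ∈ S.V₀, ∀ y ∈ S.V₀, x ≠ y → ∀ (n : ℕ) (K : Set (EuclideanSpace ℝ (Fin d))),
    S.IsCell n K →
      S.IsCell n (EuclideanGeometry.reflection (AffineSubspace.perpBisector x y) '' K)

/-- The address space `Ξ_+`: sequences which are eventually equal to the distinguished index.
The entry `η k` is the entry with number `k + 1` in the numbering that starts with `1`. -/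
def Address (N : ℕ) [NeZero N] : Type :=
  {η : ℕ → Fin N // ∃ n, ∀ k, n ≤ k → η k = 0}

namespace Address

variable {N : ℕ} [NeZero N]

/-- The constant address `(1, 1, …)`. -/
def base : Address N := ⟨fun _ => 0, 0, fun _ _ => rfl⟩

/-- The address `η · i`, with first entry `i` followed by the entries of `η`. -/
def cons (η : Address N) (i : Fin N) : Address N :=
  ⟨fun k => Nat.casesOn k i η.1, by
    obtain ⟨n, hn⟩ := η.2
    refine ⟨n + 1, fun k hk => ?_⟩
    cases k with
    | zero => omega
    | succ k => exact hn k (by omega)⟩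

end Address

namespace SimilitudeSystem

variable {d N : ℕ} [NeZero N] (S : SimilitudeSystem d N)

/-- `Ψ_{η_n} ∘ ⋯ ∘ Ψ_{η_1}`, the last entry being applied last. -/
def rev (η : ℕ → Fin N) : ℕ → EuclideanSpace ℝ (Fin d) → EuclideanSpace ℝ (Fin d)
  | 0 => id
  | n + 1 => S.Ψ (η n) ∘ rev η n

/-- The vertex `π([η, i])` of the unbounded graph with vertex set `V̂ = ⋃_n β^n V_n`, that is the
`i`-th vertex of the `0`-cell with address `η`: the (eventually constant) limit of
`β^n Ψ_{η_n}(⋯ Ψ_{η_1}(a_i))`. -/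
def vertex (η : Address N) (i : S.IFix) : EuclideanSpace ℝ (Fin d) :=
  limUnder atTop fun n : ℕ => S.β ^ n • S.rev η.1 n (S.a i.1)

/-- The renormalised energy on the `0`-cell with address `η`. The function `v` lives on the
unbounded graph and is prescribed at the points `β · π([η, i])`, that is on the vertices of the
`0`-cell with address `η` seen inside the graph magnified by `β`; the energy of `v` on the `0`-cells
with the addresses `η · k`, which fill up the magnified cell, is minimised. -/
def renormEnergy (θ : Address N → S.IFix → S.IFix → ℝ) (η : Address N) (ξ : S.IFix → ℝ) : ℝ :=
  ⨅ v : {v : EuclideanSpace ℝ (Fin d) → ℝ // ∀ i, v (S.β • S.vertex η i) = ξ i},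
    ∑ k : Fin N, S.form (θ (η.cons k)) fun j => v.1 (S.vertex (η.cons k) j)

/-- The renormalisation map `Φ̄`. The total energy `Ŝ_θ(v, v)` is half the sum of the energies of
the `0`-cells, and any two of the magnified cells meet only in points of `β V̂`, where `v` is
prescribed. So the minimisation that defines the renormalised form decouples, and `Φ̄(θ)(η)` is the
element of `𝒬` whose form is the renormalised energy on the cell with address `η`. It is
determined by this, since an element of `𝒬` is determined by its form. -/
def renorm (θ : Address N → S.IFix → S.IFix → ℝ) (η : Address N) : S.IFix → S.IFix → ℝ :=
  if h : ∃ Q, S.IsQ Q ∧ ∀ ξ, S.form Q ξ = S.renormEnergy θ η ξ then h.choose else 0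

/-- The renormalisation map `Φ̃` on `𝒬_+`: the map `Φ̄` on constant fields. -/
def renormConst (Q : S.IFix → S.IFix → ℝ) : S.IFix → S.IFix → ℝ :=
  S.renorm (fun _ => Q) Address.base

/-- The normalised renormalisation map `Φ = ϱ Φ̄`. -/
def scaledRenorm (ϱ : ℝ) (θ : Address N → S.IFix → S.IFix → ℝ) :
    Address N → S.IFix → S.IFix → ℝ :=
  ϱ • S.renorm θ

/-- `θ` is a random element of `Θ_M` (the families of elements of `𝒬_M` indexed by `Ξ_+`) under
the probability measure `P`, whose values at the different addresses are independent and
identically distributed, and bounded below by a positive multiple of `Q₀` as forms. -/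
structure IsRandomConductance {Ω : Type*} [MeasurableSpace Ω] (P : Measure Ω)
    (Q₀ : S.IFix → S.IFix → ℝ) (θ : Ω → Address N → S.IFix → S.IFix → ℝ) : Prop where
  mem : ∀ ω η, S.IsQM (θ ω η)
  measurable : ∀ η, Measurable fun ω => θ ω η
  indep : iIndepFun (fun η ω => θ ω η) P
  identDistrib : ∀ η η', IdentDistrib (fun ω => θ ω η) (fun ω => θ ω η') P P
  lower_bound : ∃ C : ℝ, 0 < C ∧ ∀ᵐ ω ∂P, ∀ η ξ, C * S.form Q₀ ξ ≤ S.form (θ ω η) ξ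

/-- For some `n₀ ≥ 1`, all entries of `Φ^{n₀}(θ)(η)` have a finite second moment. -/
def HasFiniteSecondMoments {Ω : Type*} [MeasurableSpace Ω] (P : Measure Ω) (ϱ : ℝ)
    (θ : Ω → Address N → S.IFix → S.IFix → ℝ) : Prop :=
  ∃ n₀ : ℕ, 1 ≤ n₀ ∧ ∀ (i j : S.IFix) (η : Address N),
    MemLp (fun ω => (S.scaledRenorm ϱ)^[n₀] (θ ω) η i j) 2 P

end SimilitudeSystem

end

/-!
If the conductance of `Φ^m(θ)(η)` between `i` and `j` exceeds a constant multiple of `t`, then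
`a_i` and `a_j` are joined by a chain of edges of `m`-cells with conductances at least `t` in `θ`:
otherwise the indicator function of the points that can be reached from `a_i` through such edges
would have too small an energy. An `m`-cell has diameter `β^{-m} diam V₀`, so for large `m` the
chain visits at least `L` cells, whatever `L` is. The conductances on different cells are
independent, so the tail of `Φ^m(θ)(η)_{ij}` is `O(t^{-gL})` for a fixed `g > 0`, and `m` can be
chosen such that any given moment is finite.
-/

theorem isometry_iterate {X : Type*} [PseudoEMetricSpace X] {f : X → X} (hf : Isometry f)
    (n : ℕ) : Isometry f^[n] := by
  induction n with
  | zero => exact isometry_id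
  | succ n ih => exact ih.comp hf

theorem exists_dist_iterate_lt_of_isometry {X : Type*} [PseudoMetricSpace X] {f : X → X}
    (hf : Isometry f) {K : Set X} (hK : IsCompact K) {x : X} (hx : ∀ n, f^[n] x ∈ K) {ε : ℝ}
    (hε : 0 < ε) : ∃ m, 0 < m ∧ dist (f^[m] x) x < ε := by
  obtain ⟨y, -, φ, hφ, hlim⟩ := hK.tendsto_subseq hx
  obtain ⟨n, hn⟩ := Metric.cauchySeq_iff'.1 hlim.cauchySeq ε hε
  have hlt : φ n < φ (n + 1) := hφ n.lt_succ_self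
  refine ⟨φ (n + 1) - φ n, Nat.sub_pos_of_lt hlt, ?_⟩
  rw [← (isometry_iterate hf (φ n)).dist_eq, ← Function.iterate_add_apply,
    Nat.add_sub_cancel' hlt.le]
  exact hn (n + 1) n.le_succ

theorem exists_iterate_eq_iterate_of_linearIsometryEquiv {V : Type*} [NormedAddCommGroup V]
    [NormedSpace ℝ V] [ProperSpace V] (A B : V ≃ₗᵢ[ℝ] V) (y : V) {ε : ℝ} (hε : 0 < ε) :
    ∃ m, 0 < m ∧ ∃ z, B^[m] z = A^[m] y ∧ dist z y < ε := by
  have horbit (U : V ≃ₗᵢ[ℝ] V) (n : ℕ) : U^[n] y ∈ Metric.closedBall 0 ‖y‖ := by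
    have hn := (isometry_iterate U.isometry n).dist_eq y 0
    rw [Function.iterate_fixed (map_zero U)] at hn
    rw [Metric.mem_closedBall, hn, dist_zero_right]
  obtain ⟨m, hm, hrec⟩ := exists_dist_iterate_lt_of_isometry (A.isometry.prodMap B.isometry)
    ((isCompact_closedBall 0 ‖y‖).prod (isCompact_closedBall 0 ‖y‖)) (x := (y, y))
    (fun n => by rw [Prod.map_iterate]; exact ⟨horbit A n, horbit B n⟩) (half_pos hε)
  rw [Prod.map_iterate] at hrec
  obtain ⟨hA, hB⟩ := max_lt_iff.1 hrec
  obtain ⟨z, hz⟩ := B.surjective.iterate m (A^[m] y)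
  refine ⟨m, hm, z, hz, ?_⟩
  rw [← (isometry_iterate B.isometry m).dist_eq, hz, ← add_halves ε]
  exact (dist_triangle_right _ _ y).trans_lt (add_lt_add hA hB)

/-! ### The geometry of a system of similitudes -/

namespace SimilitudeSystem

variable {d N : ℕ} (S : SimilitudeSystem d N)

theorem β_pos : 0 < S.β := one_pos.trans S.one_lt_β

theorem Ψ_injective (i : Fin N) : Function.Injective (S.Ψ i) :=
  (add_left_injective _).comp
    ((smul_right_injective _ (inv_ne_zero S.β_pos.ne')).comp (S.U i).injective)

theorem Ψ_a (i : Fin N) : S.Ψ i (S.a i) = S.a i :=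
  (S.contractingWith_Ψ i).fixedPoint_isFixedPt

theorem rev_injective (η : ℕ → Fin N) (n : ℕ) : Function.Injective (S.rev η n) := by
  induction n with
  | zero => exact Function.injective_id
  | succ n ih => exact (S.Ψ_injective _).comp ih

theorem lipschitzWith_word (w : List (Fin N)) :
    LipschitzWith (Real.toNNReal S.β⁻¹ ^ w.length) (S.word w) := by
  induction w with
  | nil => simpa [word] using LipschitzWith.id
  | cons i w ih =>
    rw [List.length_cons, pow_succ']
    exact (S.contractingWith_Ψ i).2.comp ih

theorem iterate_Ψ (i : Fin N) (m : ℕ) (y : EuclideanSpace ℝ (Fin d)) :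
    (S.Ψ i)^[m] (S.a i + y) = S.a i + S.β⁻¹ ^ m • (S.U i)^[m] y := by
  induction m generalizing y with
  | zero => simp
  | succ m ih =>
    have hΨ : S.Ψ i (S.a i + y) = S.a i + S.β⁻¹ • S.U i y := by
      conv_rhs => rw [← S.Ψ_a i]
      simp only [Ψ, map_add, smul_add]
      abel
    rw [Function.iterate_succ_apply, hΨ, ih, Function.iterate_succ_apply, pow_succ, mul_smul]
    congr 2
    exact (Function.Commute.iterate_left (g := (S.β⁻¹ • ·)) (map_smul (S.U i) S.β⁻¹) m) (S.U i y)

/-- The orthogonal parts of two maps with a common fixed point `a` are simultaneously almost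
recurrent, so if `x` is near `a` in the open set then some `Ψ_i^m x` is also the image under
`Ψ_j^m` of a point near `x`. -/
theorem a_injective {W : Set (EuclideanSpace ℝ (Fin d))} (hne : W.Nonempty) (hopen : IsOpen W)
    (hdisj : ∀ i j, i ≠ j → Disjoint (S.Ψ i '' W) (S.Ψ j '' W))
    (hsub : (⋃ i, S.Ψ i '' W) ⊆ W) : Function.Injective S.a := by
  intro i j ha
  by_contra hij
  obtain ⟨x, hx⟩ := hne
  have hmaps (k : Fin N) : Set.MapsTo (S.Ψ k) W W := fun z hz =>
    hsub (Set.mem_iUnion_of_mem k (Set.mem_image_of_mem _ hz))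
  obtain ⟨ε, hε, hball⟩ := Metric.isOpen_iff.1 hopen x hx
  obtain ⟨m, hm, z, hz, hzx⟩ :=
    exists_iterate_eq_iterate_of_linearIsometryEquiv (S.U i) (S.U j) (x - S.a i) hε
  have hzW : S.a i + z ∈ W := hball (by
    rwa [Metric.mem_ball, ← add_sub_cancel (S.a i) x, dist_add_left])
  have hmeet : (S.Ψ i)^[m] x = (S.Ψ j)^[m] (S.a i + z) := by
    rw [← add_sub_cancel (S.a i) x, S.iterate_Ψ, ha, S.iterate_Ψ, hz, ← ha]
  have himage (k : Fin N) {u : EuclideanSpace ℝ (Fin d)} (hu : u ∈ W) :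
      (S.Ψ k)^[m] u ∈ S.Ψ k '' W := by
    obtain ⟨l, rfl⟩ := Nat.exists_eq_add_one.2 hm
    rw [Function.iterate_succ_apply']
    exact Set.mem_image_of_mem _ ((hmaps k).iterate l hu)
  exact (hdisj i j hij).le_bot ⟨himage i hx, hmeet ▸ himage j hzW⟩

end SimilitudeSystem

/-! ### Energies and their traces -/

/-- Project orthogonally to the image under `L` of the kernel of `A`. -/
theorem exists_linearMap_isLeast_norm_sq {V Y H : Type*} [AddCommGroup V] [Module ℝ V]
    [AddCommGroup Y] [Module ℝ Y] [NormedAddCommGroup H] [InnerProductSpace ℝ H]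
    [FiniteDimensional ℝ H] (L : V →ₗ[ℝ] H) {A : V →ₗ[ℝ] Y} (hA : Function.Surjective A) :
    ∃ T : Y →ₗ[ℝ] H, ∀ y, IsLeast ((fun v => ‖L v‖ ^ 2) '' {v | A v = y}) (‖T y‖ ^ 2) := by
  let K : Submodule ℝ H := (LinearMap.ker A).map L
  obtain ⟨s, hs⟩ := A.exists_rightInverse_of_surjective (LinearMap.range_eq_top.2 hA)
  have hAs (y : Y) : A (s y) = y := LinearMap.congr_fun hs y
  refine ⟨Kᗮ.starProjection.toLinearMap ∘ₗ L ∘ₗ s, fun y => ⟨?_, ?_⟩⟩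
  · obtain ⟨w, hw, hwK⟩ : K.starProjection (L (s y)) ∈ K := Submodule.starProjection_apply_mem _ _
    refine ⟨s y - w, ?_, ?_⟩
    · rw [Set.mem_ofPred_eq, map_sub, hAs, LinearMap.mem_ker.1 hw, sub_zero]
    · have hproj : L (s y - w) = Kᗮ.starProjection (L (s y)) := by
        rw [map_sub, hwK, Submodule.starProjection_orthogonal_val]
      exact congrArg (‖·‖ ^ 2) hproj
  · rintro _ ⟨v, hv, rfl⟩
    have hker : L (s y - v) ∈ K := Submodule.mem_map_of_mem (by
      rw [LinearMap.mem_ker, map_sub, hAs, hv, sub_self])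
    have hproj : Kᗮ.starProjection (L (s y)) = Kᗮ.starProjection (L v) := by
      rw [← sub_eq_zero, ← map_sub, ← map_sub]
      exact Submodule.starProjection_orthogonal_apply_eq_zero hker
    have hle : ‖Kᗮ.starProjection (L (s y))‖ ≤ ‖L v‖ :=
      hproj ▸ Submodule.norm_starProjection_apply_le _ _
    exact pow_le_pow_left₀ (norm_nonneg _) hle 2

namespace SimilitudeSystem

section Form

variable {d N : ℕ} {S : SimilitudeSystem d N} {Q : S.IFix → S.IFix → ℝ}

theorem IsQ.apply_self (hQ : S.IsQ Q) (i : S.IFix) :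
    Q i i = -∑ j ∈ Finset.univ.erase i, Q i j := by
  have hrow := hQ.2 i
  rw [← Finset.add_sum_erase _ _ (Finset.mem_univ i)] at hrow
  exact eq_neg_of_add_eq_zero_left hrow

theorem form_eq_neg_dotProduct (Q : S.IFix → S.IFix → ℝ) (ξ : S.IFix → ℝ) :
    S.form Q ξ = -(ξ ⬝ᵥ Matrix.mulVec (Matrix.of Q) ξ) := by
  simp only [form, dotProduct, Matrix.mulVec, Finset.mul_sum, Matrix.of_apply]
  exact congrArg Neg.neg <|
    Finset.sum_congr rfl fun i _ => Finset.sum_congr rfl fun j _ => by ring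

theorem IsQ.four_mul_apply (hQ : S.IsQ Q) (i j : S.IFix) :
    4 * Q i j = S.form Q (Pi.single i 1 - Pi.single j 1) -
      S.form Q (Pi.single i 1 + Pi.single j 1) := by
  simp only [form_eq_neg_dotProduct, Matrix.mulVec_add, Matrix.mulVec_sub, add_dotProduct,
    dotProduct_add, sub_dotProduct, dotProduct_sub, Matrix.mulVec_single_one,
    single_one_dotProduct, Matrix.col_apply, Matrix.of_apply, hQ.1 j i]
  ring

theorem IsQ.form_eq_sum_sq (hQ : S.IsQ Q) (ξ : S.IFix → ℝ) :
    S.form Q ξ = ∑ i, ∑ j, Q i j * (ξ i - ξ j) ^ 2 / 2 := by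
  have hrow : ∑ i, ∑ j, Q i j * ξ i ^ 2 = 0 := by
    simp_rw [← Finset.sum_mul, hQ.2, zero_mul, Finset.sum_const_zero]
  have hcol : ∑ i, ∑ j, Q i j * ξ j ^ 2 = 0 := by
    rw [Finset.sum_comm, ← hrow]
    exact Finset.sum_congr rfl fun i _ => Finset.sum_congr rfl fun j _ => by rw [hQ.1 i j]
  have hexpand (i j : S.IFix) : Q i j * (ξ i - ξ j) ^ 2 / 2 =
      (1 / 2) * (Q i j * ξ i ^ 2) + (1 / 2) * (Q i j * ξ j ^ 2) - Q i j * ξ i * ξ j := by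
    ring
  simp only [hexpand, Finset.sum_sub_distrib, Finset.sum_add_distrib, ← Finset.mul_sum, hrow, hcol,
    form]
  ring

theorem IsQM.smul (hQ : S.IsQM Q) {r : ℝ} (hr : 0 ≤ r) : S.IsQM (r • Q) := by
  refine ⟨⟨fun i j => ?_, fun i => ?_⟩, fun i j hij => mul_nonneg hr (hQ.2 i j hij)⟩
  · simp only [Pi.smul_apply, hQ.1.1 i j]
  · simp only [Pi.smul_apply, ← Finset.smul_sum, hQ.1.2 i, smul_zero]

theorem IsQM.mul_sq_sub_nonneg (hQ : S.IsQM Q) (ξ : S.IFix → ℝ) (i j : S.IFix) :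
    0 ≤ Q i j * (ξ i - ξ j) ^ 2 := by
  obtain rfl | hij := eq_or_ne i j
  · simp
  · exact mul_nonneg (hQ.2 i j hij) (sq_nonneg _)

theorem IsQM.form_nonneg (hQ : S.IsQM Q) (ξ : S.IFix → ℝ) : 0 ≤ S.form Q ξ := by
  rw [hQ.1.form_eq_sum_sq]
  exact Finset.sum_nonneg fun i _ => Finset.sum_nonneg fun j _ =>
    div_nonneg (hQ.mul_sq_sub_nonneg ξ i j) zero_le_two

theorem IsQM.form_abs_le (hQ : S.IsQM Q) (ξ : S.IFix → ℝ) :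
    S.form Q (fun i => |ξ i|) ≤ S.form Q ξ := by
  simp only [hQ.1.form_eq_sum_sq]
  refine Finset.sum_le_sum fun i _ => Finset.sum_le_sum fun j _ => ?_
  obtain rfl | hij := eq_or_ne i j
  · simp
  · have hnonneg := hQ.2 i j hij
    have hsq : (|ξ i| - |ξ j|) ^ 2 ≤ (ξ i - ξ j) ^ 2 := sq_le_sq.2 (abs_abs_sub_abs_le _ _)
    gcongr

theorem IsQM.mul_sq_sub_le_form (hQ : S.IsQM Q) (ξ : S.IFix → ℝ) (i j : S.IFix) :
    Q i j * (ξ i - ξ j) ^ 2 ≤ S.form Q ξ := by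
  obtain rfl | hij := eq_or_ne i j
  · simpa using hQ.form_nonneg ξ
  rw [hQ.1.form_eq_sum_sq, ← Finset.sum_product']
  have hpair : ∑ e ∈ {(i, j), (j, i)}, Q e.1 e.2 * (ξ e.1 - ξ e.2) ^ 2 / 2 =
      Q i j * (ξ i - ξ j) ^ 2 := by
    rw [Finset.sum_pair (by simp [hij]), hQ.1.1 j i]
    ring
  rw [← hpair]
  exact Finset.sum_le_sum_of_subset_of_nonneg (by simp) fun e _ _ =>
    div_nonneg (hQ.mul_sq_sub_nonneg ξ e.1 e.2) zero_le_two

theorem IsQ.form_le_of_forall_mul_sq_sub_le (hQ : S.IsQ Q) {ξ : S.IFix → ℝ} {δ : ℝ}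
    (h : ∀ i j, Q i j * (ξ i - ξ j) ^ 2 ≤ δ) :
    S.form Q ξ ≤ Fintype.card S.IFix ^ 2 * (δ / 2) := by
  calc S.form Q ξ = ∑ i, ∑ j, Q i j * (ξ i - ξ j) ^ 2 / 2 := hQ.form_eq_sum_sq ξ
    _ ≤ ∑ _i : S.IFix, ∑ _j : S.IFix, δ / 2 := by gcongr; exact h _ _
    _ = Fintype.card S.IFix ^ 2 * (δ / 2) := by
      simp only [Finset.sum_const, Finset.card_univ, nsmul_eq_mul]
      ring

end Form

section Trace

variable {d N : ℕ} (S : SimilitudeSystem d N)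

/-- The energy of the function `u` on `V_1`, where the `1`-cell `Ψ_k(V_0)` carries the network with
conductances `M k`. -/
noncomputable def subdivisionEnergy (M : Fin N → S.IFix → S.IFix → ℝ)
    (u : EuclideanSpace ℝ (Fin d) → ℝ) : ℝ :=
  ∑ k, S.form (M k) fun j => u (S.Ψ k (S.a j.1))

/-- The trace on `V_0` of the energy on `V_1`, that is the least energy of a function with the
boundary values `ξ`. -/
noncomputable def traceEnergy (M : Fin N → S.IFix → S.IFix → ℝ) (ξ : S.IFix → ℝ) : ℝ :=
  ⨅ u : {u : EuclideanSpace ℝ (Fin d) → ℝ // (fun i : S.IFix => u (S.a i.1)) = ξ},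
    S.subdivisionEnergy M u.1

variable {S} {M : Fin N → S.IFix → S.IFix → ℝ}

theorem traceEnergy_le (hM : ∀ k, S.IsQM (M k)) (u : EuclideanSpace ℝ (Fin d) → ℝ) :
    S.traceEnergy M (fun i => u (S.a i.1)) ≤ S.subdivisionEnergy M u :=
  ciInf_le ⟨0, by
    rintro _ ⟨v, rfl⟩
    exact Finset.sum_nonneg fun k _ => (hM k).form_nonneg _⟩
    (⟨u, rfl⟩ : {v : EuclideanSpace ℝ (Fin d) → ℝ // (fun i : S.IFix => v (S.a i.1)) = _})

theorem exists_linearMap_norm_sq_eq_subdivisionEnergy (hM : ∀ k, S.IsQM (M k)) :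
    ∃ L : (EuclideanSpace ℝ (Fin d) → ℝ) →ₗ[ℝ] EuclideanSpace ℝ (Fin N × S.IFix × S.IFix),
      ∀ u, ‖L u‖ ^ 2 = S.subdivisionEnergy M u := by
  let L : (EuclideanSpace ℝ (Fin d) → ℝ) →ₗ[ℝ] Fin N × S.IFix × S.IFix → ℝ :=
    { toFun u e := √(M e.1 e.2.1 e.2.2 / 2) *
        (u (S.Ψ e.1 (S.a e.2.1.1)) - u (S.Ψ e.1 (S.a e.2.2.1)))
      map_add' u v := funext fun e => by simp only [Pi.add_apply]; ring
      map_smul' t u := funext fun e => by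
        simp only [Pi.smul_apply, smul_eq_mul, RingHom.id_apply]
        ring }
  refine ⟨(WithLp.linearEquiv 2 ℝ _).symm.toLinearMap ∘ₗ L, fun u => ?_⟩
  rw [EuclideanSpace.norm_sq_eq, Fintype.sum_prod_type]
  refine Finset.sum_congr rfl fun k _ => ?_
  rw [(hM k).1.form_eq_sum_sq, Fintype.sum_prod_type]
  refine Finset.sum_congr rfl fun i _ => Finset.sum_congr rfl fun j _ => ?_
  change ‖√(M k i j / 2) * (u (S.Ψ k (S.a i.1)) - u (S.Ψ k (S.a j.1)))‖ ^ 2 = _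
  obtain rfl | hij := eq_or_ne i j
  · simp
  · rw [Real.norm_eq_abs, sq_abs, mul_pow,
      Real.sq_sqrt (div_nonneg ((hM k).2 i j hij) zero_le_two), div_mul_eq_mul_div]

theorem form_neg_inner {H : Type*} [NormedAddCommGroup H] [InnerProductSpace ℝ H]
    (v : S.IFix → H) (ξ : S.IFix → ℝ) :
    S.form (fun i j => -inner ℝ (v i) (v j)) ξ = ‖∑ i, ξ i • v i‖ ^ 2 := by
  simp only [form, ← real_inner_self_eq_norm_sq, sum_inner, inner_sum, real_inner_smul_left,
    real_inner_smul_right, ← Finset.sum_neg_distrib]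
  exact Finset.sum_congr rfl fun i _ => Finset.sum_congr rfl fun j _ => by
    rw [real_inner_comm]
    ring

theorem exists_form_eq_traceEnergy (ha : Function.Injective fun i : S.IFix => S.a i.1)
    (hM : ∀ k, S.IsQM (M k)) : ∃ Q, S.IsQ Q ∧ ∀ ξ, S.form Q ξ = S.traceEnergy M ξ := by
  obtain ⟨L, hL⟩ := exists_linearMap_norm_sq_eq_subdivisionEnergy hM
  obtain ⟨T, hT⟩ := exists_linearMap_isLeast_norm_sq L
    (LinearMap.funLeft_surjective_of_injective ℝ ℝ _ ha)
  have htrace (ξ : S.IFix → ℝ) : S.traceEnergy M ξ = ‖T ξ‖ ^ 2 := by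
    rw [← (hT ξ).csInf_eq, sInf_image']
    exact iInf_congr fun u => (hL u.1).symm
  have hT_one : T 1 = 0 := by
    have hle : ‖T 1‖ ^ 2 ≤ 0 := by
      rw [← htrace]
      refine (traceEnergy_le hM 1).trans_eq ?_
      simp [subdivisionEnergy, (hM _).1.form_eq_sum_sq]
    exact norm_eq_zero.1 (pow_eq_zero_iff two_ne_zero |>.1 (hle.antisymm (sq_nonneg _)))
  have hT_sum (ξ : S.IFix → ℝ) : ∑ i, ξ i • T (Pi.single i 1) = T ξ := by
    simp_rw [← map_smul, ← map_sum, ← pi_eq_sum_univ' ξ]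
  refine ⟨fun i j => -inner ℝ (T (Pi.single i 1)) (T (Pi.single j 1)), ⟨fun i j => ?_, fun i => ?_⟩,
    fun ξ => ?_⟩
  · exact congrArg Neg.neg (real_inner_comm _ _)
  · have hrow := hT_sum 1
    simp only [Pi.one_apply, one_smul, hT_one] at hrow
    rw [Finset.sum_neg_distrib, ← inner_sum, hrow, inner_zero_right, neg_zero]
  · rw [htrace, form_neg_inner, hT_sum]

theorem traceEnergy_abs_le (ha : Function.Injective fun i : S.IFix => S.a i.1)
    (hM : ∀ k, S.IsQM (M k)) (ξ : S.IFix → ℝ) :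
    S.traceEnergy M (fun i => |ξ i|) ≤ S.traceEnergy M ξ := by
  have : Nonempty {u : EuclideanSpace ℝ (Fin d) → ℝ // (fun i : S.IFix => u (S.a i.1)) = ξ} :=
    ⟨Function.extend _ ξ 0, funext fun i => ha.extend_apply ξ 0 i⟩
  refine le_ciInf ?_
  rintro ⟨u, rfl⟩
  exact (traceEnergy_le hM fun x => |u x|).trans
    (Finset.sum_le_sum fun k _ => (hM k).form_abs_le _)

theorem isQM_of_form_eq_traceEnergy (ha : Function.Injective fun i : S.IFix => S.a i.1)
    (hM : ∀ k, S.IsQM (M k)) {Q : S.IFix → S.IFix → ℝ} (hQ : S.IsQ Q)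
    (hform : ∀ ξ, S.form Q ξ = S.traceEnergy M ξ) : S.IsQM Q := by
  refine ⟨hQ, fun i j hij => ?_⟩
  have habs : (fun l => |(Pi.single i 1 - Pi.single j 1 : S.IFix → ℝ) l|) =
      Pi.single i 1 + Pi.single j 1 := by
    ext l
    obtain rfl | hli := eq_or_ne l i
    · simp [hij]
    · obtain rfl | hlj := eq_or_ne l j <;> simp [*]
  have hle := traceEnergy_abs_le ha hM (Pi.single i 1 - Pi.single j 1)
  rw [habs, ← hform, ← hform] at hle
  linarith [hQ.four_mul_apply i j]

theorem measurable_traceEnergy {Ω : Type*} [MeasurableSpace Ω]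
    {M : Ω → Fin N → S.IFix → S.IFix → ℝ} (hM : ∀ ω k, S.IsQM (M ω k)) (hmeas : Measurable M)
    (ξ : S.IFix → ℝ) : Measurable fun ω => S.traceEnergy (M ω) ξ := by
  let f (u : {u : EuclideanSpace ℝ (Fin d) → ℝ // (fun i : S.IFix => u (S.a i.1)) = ξ})
      (M : Fin N → S.IFix → S.IFix → ℝ) : ℝ :=
    ∑ k, ∑ i, ∑ j, |M k i j| * (u.1 (S.Ψ k (S.a i.1)) - u.1 (S.Ψ k (S.a j.1))) ^ 2 / 2
  have hf : UpperSemicontinuous fun M => ⨅ u, f u M := by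
    refine upperSemicontinuous_ciInf (fun M => ⟨0, ?_⟩) fun u => Continuous.upperSemicontinuous ?_
    · rintro _ ⟨u, rfl⟩
      positivity
    · fun_prop
  have hfM (u) (ω : Ω) : S.subdivisionEnergy (M ω) u.1 = f u (M ω) := by
    refine Finset.sum_congr rfl fun k _ => ((hM ω k).1.form_eq_sum_sq _).trans <|
      Finset.sum_congr rfl fun i _ => Finset.sum_congr rfl fun j _ => ?_
    obtain rfl | hij := eq_or_ne i j
    · simp
    · rw [abs_of_nonneg ((hM ω k).2 i j hij)]
  simp only [traceEnergy, hfM]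
  exact hf.measurable.comp hmeas

end Trace

section Renorm

variable {d N : ℕ} [NeZero N] (S : SimilitudeSystem d N)

/-- The map `x ↦ lim_n β^n Ψ_{η_n}(⋯ Ψ_{η_1}(x))`, which carries `V_0` onto the `0`-cell of the
unbounded graph with address `η`. -/
noncomputable def addressMap (η : Address N) (x : EuclideanSpace ℝ (Fin d)) :
    EuclideanSpace ℝ (Fin d) :=
  limUnder atTop fun n : ℕ => S.β ^ n • S.rev η.1 n x

theorem rev_cons (η : Address N) (k : Fin N) (n : ℕ) (x : EuclideanSpace ℝ (Fin d)) :
    S.rev (η.cons k).1 (n + 1) x = S.rev η.1 n (S.Ψ k x) := by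
  induction n with
  | zero => rfl
  | succ n ih => exact congrArg (S.Ψ (η.1 n)) ih

variable {S} (h0 : ∀ x, S.Ψ 0 x = S.β⁻¹ • x)

include h0

theorem exists_forall_ge_addressMap_eq (η : Address N) :
    ∃ n, ∀ m, n ≤ m → ∀ x, S.addressMap η x = S.β ^ m • S.rev η.1 m x := by
  obtain ⟨n, hn⟩ := η.2
  have hconst (m : ℕ) (hm : n ≤ m) (x) :
      S.β ^ m • S.rev η.1 m x = S.β ^ n • S.rev η.1 n x := by
    induction m, hm using Nat.le_induction with
    | base => rfl
    | succ m hm ih =>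
      rw [← ih, rev, Function.comp_apply, hn m hm, h0, pow_succ, mul_smul,
        smul_inv_smul₀ S.β_pos.ne']
  refine ⟨n, fun m hm x => ?_⟩
  have hev : ∀ᶠ l in atTop, S.β ^ n • S.rev η.1 n x = S.β ^ l • S.rev η.1 l x :=
    eventually_atTop.2 ⟨n, fun l hl => (hconst l hl x).symm⟩
  rw [hconst m hm]
  exact (tendsto_const_nhds.congr' hev).limUnder_eq

theorem addressMap_injective (η : Address N) : Function.Injective (S.addressMap η) := by
  obtain ⟨n, hn⟩ := exists_forall_ge_addressMap_eq h0 η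
  rw [funext (hn n le_rfl)]
  exact (smul_right_injective _ (pow_ne_zero n S.β_pos.ne')).comp (S.rev_injective η.1 n)

theorem addressMap_cons (η : Address N) (k : Fin N) (x : EuclideanSpace ℝ (Fin d)) :
    S.addressMap (η.cons k) x = S.β • S.addressMap η (S.Ψ k x) := by
  obtain ⟨n, hn⟩ := exists_forall_ge_addressMap_eq h0 η
  obtain ⟨n', hn'⟩ := exists_forall_ge_addressMap_eq h0 (η.cons k)
  rw [hn _ (le_max_left n n'), hn' _ ((le_max_right n n').trans (Nat.le_succ _)), rev_cons,
    pow_succ', mul_smul]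

theorem renormEnergy_eq_traceEnergy (θ : Address N → S.IFix → S.IFix → ℝ) (η : Address N)
    (ξ : S.IFix → ℝ) : S.renormEnergy θ η ξ = S.traceEnergy (fun k => θ (η.cons k)) ξ := by
  let G (x : EuclideanSpace ℝ (Fin d)) := S.β • S.addressMap η x
  have hG : Function.Injective G :=
    (smul_right_injective _ S.β_pos.ne').comp (addressMap_injective h0 η)
  have hcons (k : Fin N) (j : S.IFix) : S.vertex (η.cons k) j = G (S.Ψ k (S.a j.1)) :=
    addressMap_cons h0 η k _
  refine Function.Surjective.iInf_congr (fun v => ⟨v.1 ∘ G, funext v.2⟩) ?_ fun v => ?_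
  · rintro ⟨u, rfl⟩
    exact ⟨⟨Function.extend G u 0, fun i => hG.extend_apply u 0 _⟩,
      Subtype.ext (Function.extend_comp hG u 0)⟩
  · simp only [subdivisionEnergy, hcons, Function.comp_apply]

variable (ha : Function.Injective fun i : S.IFix => S.a i.1)

include ha

theorem renorm_spec {θ : Address N → S.IFix → S.IFix → ℝ} {η : Address N}
    (hθ : ∀ k, S.IsQM (θ (η.cons k))) :
    S.IsQ (S.renorm θ η) ∧
      ∀ ξ, S.form (S.renorm θ η) ξ = S.traceEnergy (fun k => θ (η.cons k)) ξ := by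
  have hex : ∃ Q, S.IsQ Q ∧ ∀ ξ, S.form Q ξ = S.renormEnergy θ η ξ := by
    simpa only [renormEnergy_eq_traceEnergy h0] using exists_form_eq_traceEnergy ha hθ
  rw [renorm, dif_pos hex]
  simpa only [renormEnergy_eq_traceEnergy h0] using hex.choose_spec

theorem isQM_renorm {θ : Address N → S.IFix → S.IFix → ℝ} {η : Address N}
    (hθ : ∀ k, S.IsQM (θ (η.cons k))) : S.IsQM (S.renorm θ η) :=
  isQM_of_form_eq_traceEnergy ha hθ (renorm_spec h0 ha hθ).1 (renorm_spec h0 ha hθ).2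

theorem isQM_iterate_scaledRenorm {ϱ : ℝ} (hϱ : 0 ≤ ϱ) {θ : Address N → S.IFix → S.IFix → ℝ}
    (hθ : ∀ η, S.IsQM (θ η)) (n : ℕ) (η : Address N) :
    S.IsQM ((S.scaledRenorm ϱ)^[n] θ η) := by
  induction n generalizing η with
  | zero => exact hθ η
  | succ n ih =>
    rw [Function.iterate_succ_apply']
    exact (isQM_renorm h0 ha fun k => ih (η.cons k)).smul hϱ

theorem measurable_renorm {Ω : Type*} [MeasurableSpace Ω]
    {θ : Ω → Address N → S.IFix → S.IFix → ℝ} (hθ : ∀ ω η, S.IsQM (θ ω η))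
    (hmeas : ∀ η, Measurable fun ω => θ ω η) (η : Address N) :
    Measurable fun ω => S.renorm (θ ω) η := by
  refine measurable_pi_lambda _ fun i => measurable_pi_lambda _ fun j => ?_
  have hpolar (ω : Ω) : S.renorm (θ ω) η i j =
      (S.traceEnergy (fun k => θ ω (η.cons k)) (Pi.single i 1 - Pi.single j 1) -
        S.traceEnergy (fun k => θ ω (η.cons k)) (Pi.single i 1 + Pi.single j 1)) / 4 := by
    obtain ⟨hQ, hform⟩ := renorm_spec h0 ha fun k => hθ ω (η.cons k)
    rw [← hform, ← hform, ← hQ.four_mul_apply, mul_div_cancel_left₀ _ four_ne_zero]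
  have htrace := measurable_traceEnergy (fun ω k => hθ ω (η.cons k))
    (measurable_pi_lambda _ fun k => hmeas (η.cons k))
  simp only [hpolar]
  exact ((htrace _).sub (htrace _)).div_const 4

theorem measurable_iterate_scaledRenorm {ϱ : ℝ} (hϱ : 0 ≤ ϱ) {Ω : Type*} [MeasurableSpace Ω]
    {θ : Ω → Address N → S.IFix → S.IFix → ℝ} (hθ : ∀ ω η, S.IsQM (θ ω η))
    (hmeas : ∀ η, Measurable fun ω => θ ω η) (n : ℕ) (η : Address N) :
    Measurable fun ω => (S.scaledRenorm ϱ)^[n] (θ ω) η := by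
  induction n generalizing η with
  | zero => exact hmeas η
  | succ n ih =>
    simp_rw [Function.iterate_succ_apply']
    exact (measurable_renorm h0 ha (fun ω => isQM_iterate_scaledRenorm h0 ha hϱ (hθ ω) n) ih
      η).const_smul ϱ

end Renorm

end SimilitudeSystem

/-! ### Chains of large conductances -/

/-- The address `w · η` obtained from `η` by prefixing the entries of `w`, the first of them being
prefixed first. -/
def Address.extend {N : ℕ} [NeZero N] (η : Address N) (w : List (Fin N)) : Address N :=
  w.foldl Address.cons η

theorem Address.cons_inj {N : ℕ} [NeZero N] {η η' : Address N} {k k' : Fin N} :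
    η.cons k = η'.cons k' ↔ η = η' ∧ k = k' := by
  refine ⟨fun h => ?_, fun ⟨hη, hk⟩ => hη ▸ hk ▸ rfl⟩
  have happly (n : ℕ) : (η.cons k).1 n = (η'.cons k').1 n := by rw [h]
  exact ⟨Subtype.ext (funext fun n => happly (n + 1)), happly 0⟩

theorem Address.extend_inj_of_length_eq {N : ℕ} [NeZero N] {η η' : Address N}
    {w w' : List (Fin N)} (hlen : w.length = w'.length) :
    η.extend w = η'.extend w' ↔ η = η' ∧ w = w' := by
  induction w generalizing η η' w' with
  | nil =>
    obtain rfl := List.length_eq_zero_iff.1 hlen.symm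
    simp [Address.extend]
  | cons k w ih =>
    obtain ⟨k', w', rfl⟩ := List.exists_cons_of_length_eq_add_one hlen.symm
    rw [List.cons.injEq, ← and_assoc, ← Address.cons_inj]
    exact ih (Nat.succ.inj hlen)

namespace SimilitudeSystem

variable {d N : ℕ} (S : SimilitudeSystem d N)

/-- The cell `f k (V_0)` of some `k` has an edge from `x` to `y` whose conductance, given by the
matrix `M k`, is at least `t`. -/
def LargeEdge {ι : Type*} (f : ι → EuclideanSpace ℝ (Fin d) → EuclideanSpace ℝ (Fin d))
    (M : ι → S.IFix → S.IFix → ℝ) (t : ℝ) (x y : EuclideanSpace ℝ (Fin d)) : Prop :=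
  ∃ k i j, i ≠ j ∧ t ≤ M k i j ∧ x = f k (S.a i.1) ∧ y = f k (S.a j.1)

variable {S}

theorem subdivisionEnergy_indicator_le {M : Fin N → S.IFix → S.IFix → ℝ} (hM : ∀ k, S.IsQM (M k))
    {t : ℝ} (ht : 0 ≤ t) {A : Set (EuclideanSpace ℝ (Fin d))}
    (hA : ∀ x y, S.LargeEdge S.Ψ M t x y → x ∈ A → y ∈ A) :
    S.subdivisionEnergy M (A.indicator 1) ≤ N * (Fintype.card S.IFix ^ 2 * (t / 2)) := by
  let u : EuclideanSpace ℝ (Fin d) → ℝ := A.indicator 1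
  have hedge (k : Fin N) (i j : S.IFix) :
      M k i j * (u (S.Ψ k (S.a i.1)) - u (S.Ψ k (S.a j.1))) ^ 2 ≤ t := by
    obtain rfl | hij := eq_or_ne i j
    · simpa using ht
    obtain hlarge | hsmall := le_or_gt t (M k i j)
    · have hmem : S.Ψ k (S.a i.1) ∈ A ↔ S.Ψ k (S.a j.1) ∈ A :=
        ⟨hA _ _ ⟨k, i, j, hij, hlarge, rfl, rfl⟩,
          hA _ _ ⟨k, j, i, hij.symm, (hM k).1.1 i j ▸ hlarge, rfl, rfl⟩⟩
      simpa [u, Set.indicator_apply, hmem] using ht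
    · have hsq : (u (S.Ψ k (S.a i.1)) - u (S.Ψ k (S.a j.1))) ^ 2 ≤ 1 := by
        simp only [u, Set.indicator_apply, Pi.one_apply]
        split_ifs <;> norm_num
      exact (mul_le_of_le_one_right ((hM k).2 i j hij) hsq).trans hsmall.le
  refine (Finset.sum_le_card_nsmul _ _ _ fun k _ =>
    (hM k).1.form_le_of_forall_mul_sq_sub_le (hedge k)).trans_eq ?_
  simp

/-- Otherwise the indicator function of the set of the points that are joined to `a_i` by large
edges would have too small an energy. -/
theorem reflTransGen_largeEdge_of_le {M : Fin N → S.IFix → S.IFix → ℝ} (hM : ∀ k, S.IsQM (M k))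
    {Q : S.IFix → S.IFix → ℝ} (hQ : S.IsQM Q) (hform : ∀ ξ, S.form Q ξ = S.traceEnergy M ξ)
    {t : ℝ} (ht : 0 < t) {i j : S.IFix} (h : N * Fintype.card S.IFix ^ 2 * t ≤ Q i j) :
    Relation.ReflTransGen (S.LargeEdge S.Ψ M t) (S.a i.1) (S.a j.1) := by
  by_contra hchain
  let A := {x | Relation.ReflTransGen (S.LargeEdge S.Ψ M t) (S.a i.1) x}
  have hi : S.a i.1 ∈ A := Relation.ReflTransGen.refl
  have hj : S.a j.1 ∉ A := hchain
  have hle : Q i j ≤ N * (Fintype.card S.IFix ^ 2 * (t / 2)) :=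
    calc Q i j = Q i j * (A.indicator 1 (S.a i.1) - A.indicator 1 (S.a j.1) : ℝ) ^ 2 := by
          rw [Set.indicator_of_mem hi, Set.indicator_of_notMem hj]
          simp
      _ ≤ S.form Q fun l => A.indicator 1 (S.a l.1) :=
          hQ.mul_sq_sub_le_form (fun l => A.indicator 1 (S.a l.1)) i j
      _ ≤ S.subdivisionEnergy M (A.indicator 1) := (hform _).trans_le (traceEnergy_le hM _)
      _ ≤ N * (Fintype.card S.IFix ^ 2 * (t / 2)) :=
          subdivisionEnergy_indicator_le hM ht.le fun x y hxy hx => hx.tail hxy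
  have hN : (0 : ℝ) < N := Nat.cast_pos.2 i.1.pos
  have hcard : (0 : ℝ) < Fintype.card S.IFix := Nat.cast_pos.2 (Fintype.card_pos_iff.2 ⟨i⟩)
  have hpos : 0 < N * Fintype.card S.IFix ^ 2 * t := by positivity
  linarith

variable [NeZero N]

theorem reflTransGen_largeEdge_iterate_of_le (h0 : ∀ x, S.Ψ 0 x = S.β⁻¹ • x)
    (ha : Function.Injective fun i : S.IFix => S.a i.1) {ϱ : ℝ} (hϱ : 0 < ϱ)
    {θ : Address N → S.IFix → S.IFix → ℝ} (hθ : ∀ η, S.IsQM (θ η)) {t : ℝ} (ht : 0 < t) (m : ℕ)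
    {η : Address N} {i j : S.IFix} (hij : i ≠ j)
    (h : (ϱ * (N * Fintype.card S.IFix ^ 2)) ^ m * t ≤ (S.scaledRenorm ϱ)^[m] θ η i j) :
    Relation.ReflTransGen (S.LargeEdge (fun w : List.Vector (Fin N) m => S.word w.1)
      (fun w => θ (η.extend w.1)) t) (S.a i.1) (S.a j.1) := by
  set C : ℝ := N * Fintype.card S.IFix ^ 2
  have hN : (0 : ℝ) < N := Nat.cast_pos.2 i.1.pos
  have hcard : (0 : ℝ) < Fintype.card S.IFix := Nat.cast_pos.2 (Fintype.card_pos_iff.2 ⟨i⟩)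
  have hC : 0 < C := by positivity
  induction m generalizing η i j with
  | zero => exact .single ⟨⟨[], rfl⟩, i, j, hij, by simpa [Address.extend] using h, rfl, rfl⟩
  | succ m ih =>
    have hθm := isQM_iterate_scaledRenorm h0 ha hϱ.le hθ m
    rw [Function.iterate_succ_apply', pow_succ', mul_assoc, mul_assoc] at h
    have hcoarse := reflTransGen_largeEdge_of_le (fun k => hθm (η.cons k))
      (isQM_renorm h0 ha fun k => hθm _) (renorm_spec h0 ha fun k => hθm _).2
      (mul_pos (pow_pos (mul_pos hϱ hC) m) ht) (le_of_mul_le_mul_left h hϱ)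
    refine hcoarse.lift' id ?_
    rintro _ _ ⟨k, i', j', hij', hlarge, rfl, rfl⟩
    refine (ih hij' hlarge).lift (S.Ψ k) ?_
    rintro _ _ ⟨w, i₁, j₁, hij₁, hlarge₁, rfl, rfl⟩
    exact ⟨w.cons k, i₁, j₁, hij₁, hlarge₁, rfl, rfl⟩

end SimilitudeSystem

section Chain

variable {X ι : Type*}

/-- The points `x` and `y` are joined by a chain of sets from the finite family `(K w)_{w ∈ B}`. -/
def ChainJoined (K : ι → Set X) (B : Finset ι) : X → X → Prop :=
  Relation.ReflTransGen fun u v => ∃ w ∈ B, u ∈ K w ∧ v ∈ K w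

theorem ChainJoined.erase_or_exists_mem {K : ι → Set X} {B : Finset ι} {x y : X}
    (h : ChainJoined K B x y) (w : ι) :
    ChainJoined K (B.erase w) x y ∨ ∃ z ∈ K w, ChainJoined K (B.erase w) z y := by
  induction h using Relation.ReflTransGen.head_induction_on with
  | refl => exact .inl .refl
  | @head u v huv _ ih =>
    obtain ih | ih := ih
    · obtain ⟨w', hw', hu, hv⟩ := huv
      obtain rfl | hne := eq_or_ne w' w
      · exact .inr ⟨v, hv, ih⟩
      · exact .inl (.head ⟨w', Finset.mem_erase.2 ⟨hne, hw'⟩, hu, hv⟩ ih)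
    · exact .inr ih

theorem ChainJoined.edist_le_sum_ediam [PseudoEMetricSpace X] {K : ι → Set X} {B : Finset ι}
    {x y : X} (h : ChainJoined K B x y) : edist x y ≤ ∑ w ∈ B, Metric.ediam (K w) := by
  induction B using Finset.strongInduction generalizing x with
  | H B ih =>
    obtain rfl | ⟨x', ⟨w, hwB, hx, hx'⟩, htail⟩ := Relation.ReflTransGen.cases_head h
    · simp
    obtain ⟨z, hz, hzy⟩ : ∃ z ∈ K w, ChainJoined K (B.erase w) z y :=
      (ChainJoined.erase_or_exists_mem htail w).elim (fun hx'y => ⟨x', hx', hx'y⟩) id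
    calc edist x y ≤ edist x z + edist z y := edist_triangle x z y
      _ ≤ Metric.ediam (K w) + ∑ w' ∈ B.erase w, Metric.ediam (K w') :=
          add_le_add (Metric.edist_le_ediam_of_mem hx hz) (ih _ (Finset.erase_ssubset hwB) hzy)
      _ = ∑ w ∈ B, Metric.ediam (K w) := Finset.add_sum_erase B (fun w => Metric.ediam (K w)) hwB

end Chain

namespace SimilitudeSystem

variable {d N : ℕ} {S : SimilitudeSystem d N}

variable (S) in
/-- The words of the `m`-cells that have an edge of conductance at least `t`. -/
noncomputable def largeCells {m : ℕ} (M : List.Vector (Fin N) m → S.IFix → S.IFix → ℝ) (t : ℝ) :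
    Finset (List.Vector (Fin N) m) :=
  {w | ∃ i j, i ≠ j ∧ t ≤ M w i j}

theorem edist_le_card_largeCells_mul {m : ℕ} {M : List.Vector (Fin N) m → S.IFix → S.IFix → ℝ}
    {t : ℝ} {x y : EuclideanSpace ℝ (Fin d)}
    (h : Relation.ReflTransGen (S.LargeEdge (fun w => S.word w.1) M t) x y) :
    edist x y ≤
      (S.largeCells M t).card * ((Real.toNNReal S.β⁻¹ : ENNReal) ^ m * Metric.ediam S.V₀) := by
  have hchain : ChainJoined (fun w => S.word w.1 '' S.V₀) (S.largeCells M t) x y :=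
    Relation.ReflTransGen.mono (fun u v ⟨w, i, j, hij, hle, hu, hv⟩ =>
      ⟨w, by simpa [largeCells] using ⟨i, j, hij, hle⟩, ⟨_, i.2, hu.symm⟩, ⟨_, j.2, hv.symm⟩⟩) _ _ h
  rw [← nsmul_eq_mul]
  refine hchain.edist_le_sum_ediam.trans (Finset.sum_le_card_nsmul _ _ _ fun w _ => ?_)
  simpa [w.2] using (S.lipschitzWith_word w.1).ediam_image_le S.V₀

theorem ediam_V₀_ne_top : Metric.ediam S.V₀ ≠ ⊤ :=
  ((Set.finite_range S.a).subset fun _ hx => hx.1).isBounded.ediam_ne_top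

theorem eventually_forall_le_card_largeCells (ha : Function.Injective fun i : S.IFix => S.a i.1)
    (L : ℕ) : ∀ᶠ m in atTop, ∀ (M : List.Vector (Fin N) m → S.IFix → S.IFix → ℝ) (t : ℝ)
      (i j : S.IFix), i ≠ j →
      Relation.ReflTransGen (S.LargeEdge (fun w => S.word w.1) M t) (S.a i.1) (S.a j.1) →
        L ≤ (S.largeCells M t).card := by
  have hlim : Tendsto (fun m : ℕ => L * ((Real.toNNReal S.β⁻¹ : ENNReal) ^ m * Metric.ediam S.V₀))
      atTop (nhds 0) := by
    have hβ : (Real.toNNReal S.β⁻¹ : ENNReal) < 1 := by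
      exact_mod_cast Real.toNNReal_lt_one.2 (inv_lt_one_of_one_lt₀ S.one_lt_β)
    simpa using ENNReal.Tendsto.const_mul (ENNReal.Tendsto.mul_const
      (ENNReal.tendsto_pow_atTop_nhds_zero_of_lt_one hβ) (.inr ediam_V₀_ne_top))
      (.inr (ENNReal.natCast_ne_top L))
  have hsmall (i j : S.IFix) : ∀ᶠ m : ℕ in atTop, i ≠ j →
      L * ((Real.toNNReal S.β⁻¹ : ENNReal) ^ m * Metric.ediam S.V₀) <
        edist (S.a i.1) (S.a j.1) := by
    by_cases hij : i = j
    · simp [hij]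
    · filter_upwards [hlim.eventually_lt_const (edist_pos.2 (ha.ne hij))] with m hm _ using hm
  filter_upwards [eventually_all.2 fun i => eventually_all.2 (hsmall i)]
    with m hm M t i j hij hchain
  by_contra! hlt
  refine (edist_le_card_largeCells_mul hchain).not_gt ((hm i j hij).trans_le' ?_)
  gcongr

end SimilitudeSystem

/-! ### Moments -/

section Moments

variable {Ω ι : Type*} [MeasurableSpace Ω] {P : Measure Ω}

theorem memLp_of_forall_measureReal_le_rpow [IsFiniteMeasure P] {E : Type*} [NormedAddCommGroup E]
    {X : Ω → E} (hX : AEStronglyMeasurable X P) {p : ENNReal} (hp : p ≠ ⊤) {q C : ℝ}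
    (hpq : p.toReal < q)
    (h : ∀ t : ℝ, 1 ≤ t → P.real {ω | t ≤ ‖X ω‖} ≤ C * t ^ (-q)) : MemLp X p P := by
  obtain rfl | hp0 := eq_or_ne p 0
  · exact memLp_zero_iff_aestronglyMeasurable.2 hX
  refine ⟨hX, (eLpNorm_lt_top_iff_lintegral_rpow_enorm_lt_top hp0 hp).2 ?_⟩
  have hr : 0 < p.toReal := ENNReal.toReal_pos hp0 hp
  set r := p.toReal
  have hlayer := lintegral_rpow_eq_lintegral_meas_le_mul P
    (Eventually.of_forall fun ω => norm_nonneg (X ω)) hX.norm.aemeasurable hr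
  simp only [← ENNReal.ofReal_rpow_of_nonneg (norm_nonneg _) hr.le, ofReal_norm] at hlayer
  have hsmall :
      ∫⁻ t in Set.Ioc (0 : ℝ) 1, P {ω | t ≤ ‖X ω‖} * ENNReal.ofReal (t ^ (r - 1)) < ⊤ := by
    have hint : IntegrableOn (fun t : ℝ => t ^ (r - 1)) (Set.Ioc 0 1) :=
      (intervalIntegrable_iff_integrableOn_Ioc_of_le zero_le_one).1
        (intervalIntegral.intervalIntegrable_rpow' (by linarith))
    calc _ ≤ ∫⁻ t in Set.Ioc (0 : ℝ) 1, P Set.univ * ENNReal.ofReal (t ^ (r - 1)) :=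
          lintegral_mono fun t => mul_le_mul_left (measure_mono (Set.subset_univ _)) _
      _ = P Set.univ * ∫⁻ t in Set.Ioc (0 : ℝ) 1, ENNReal.ofReal (t ^ (r - 1)) :=
          lintegral_const_mul' _ _ (measure_ne_top _ _)
      _ < ⊤ := ENNReal.mul_lt_top (measure_lt_top _ _) hint.lintegral_lt_top
  have hlarge :
      ∫⁻ t in Set.Ioi (1 : ℝ), P {ω | t ≤ ‖X ω‖} * ENNReal.ofReal (t ^ (r - 1)) < ⊤ := by
    have hint : IntegrableOn (fun t : ℝ => C * t ^ (-q + (r - 1))) (Set.Ioi 1) :=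
      (integrableOn_Ioi_rpow_of_lt (by linarith) zero_lt_one).const_mul C
    refine (setLIntegral_mono' measurableSet_Ioi fun t ht => ?_).trans_lt hint.lintegral_lt_top
    have ht0 : 0 < t := zero_lt_one.trans ht
    rw [← ofReal_measureReal, ← ENNReal.ofReal_mul measureReal_nonneg, Real.rpow_add ht0,
      ← mul_assoc]
    gcongr
    exact h t (le_of_lt ht)
  rw [hlayer, ← Set.Ioc_union_Ioi_eq_Ioi zero_le_one]
  exact ENNReal.mul_lt_top ENNReal.ofReal_lt_top
    ((lintegral_union_le _ _ _).trans_lt (ENNReal.add_lt_top.2 ⟨hsmall, hlarge⟩))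

theorem measureReal_le_card_filter_mem_le {E : Type*} [MeasurableSpace E] {Y : ι → Ω → E}
    (hY : iIndepFun Y P) {A : Set E} (hA : MeasurableSet A) {D : Finset ι} {r : ℝ}
    (hr : ∀ i ∈ D, P.real (Y i ⁻¹' A) ≤ r) (L : ℕ) :
    P.real {ω | L ≤ (D.filter fun i => Y i ω ∈ A).card} ≤ D.card.choose L * r ^ L := by
  have := hY.isProbabilityMeasure
  have hsub : {ω | L ≤ (D.filter fun i => Y i ω ∈ A).card} ⊆
      ⋃ B ∈ D.powersetCard L, ⋂ i ∈ B, Y i ⁻¹' A := by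
    intro ω hω
    obtain ⟨B, hB, hcard⟩ := Finset.exists_subset_card_eq hω
    exact Set.mem_biUnion (Finset.mem_powersetCard.2 ⟨hB.trans (Finset.filter_subset _ _), hcard⟩)
      (Set.mem_iInter₂.2 fun i hi => (Finset.mem_filter.1 (hB hi)).2)
  have hinter (B) (hB : B ∈ D.powersetCard L) : P.real (⋂ i ∈ B, Y i ⁻¹' A) ≤ r ^ L := by
    obtain ⟨hBD, rfl⟩ := Finset.mem_powersetCard.1 hB
    rw [measureReal_def, hY.measure_inter_preimage_eq_mul B fun i _ => hA, ENNReal.toReal_prod]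
    exact (Finset.prod_le_prod (fun _ _ => ENNReal.toReal_nonneg)
      fun i hi => hr i (hBD hi)).trans_eq (Finset.prod_const r)
  calc P.real {ω | L ≤ (D.filter fun i => Y i ω ∈ A).card}
      ≤ P.real (⋃ B ∈ D.powersetCard L, ⋂ i ∈ B, Y i ⁻¹' A) :=
        measureReal_mono hsub (measure_ne_top _ _)
    _ ≤ ∑ B ∈ D.powersetCard L, P.real (⋂ i ∈ B, Y i ⁻¹' A) := measureReal_biUnion_finset_le _ _
    _ ≤ (D.powersetCard L).card • r ^ L := Finset.sum_le_card_nsmul _ _ _ hinter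
    _ = D.card.choose L * r ^ L := by rw [Finset.card_powersetCard, nsmul_eq_mul]

theorem exists_forall_measureReal_exists_le_rpow {κ : Type*} [Finite κ] {X : ι → κ → Ω → ℝ}
    {c : ℝ} {γ : κ → ℝ} (hγ : ∀ k, 0 < γ k)
    (h : ∀ i k t, 1 ≤ t → P.real {ω | t ≤ X i k ω} ≤ c * t ^ (-γ k)) :
    ∃ g > (0 : ℝ), ∃ C : ℝ, ∀ i t, 1 ≤ t → P.real {ω | ∃ k, t ≤ X i k ω} ≤ C * t ^ (-g) := by
  have := Fintype.ofFinite κ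
  obtain ⟨g, hg, hgγ⟩ : ∃ g > 0, ∀ k, g ≤ γ k := by
    cases isEmpty_or_nonempty κ
    · exact ⟨1, one_pos, isEmptyElim⟩
    · obtain ⟨k, hk⟩ := Finite.exists_min γ
      exact ⟨γ k, hγ k, hk⟩
  refine ⟨g, hg, Fintype.card κ * |c|, fun i t ht => ?_⟩
  calc P.real {ω | ∃ k, t ≤ X i k ω} ≤ ∑ k, P.real {ω | t ≤ X i k ω} := by
        rw [Set.ofPred_exists]
        exact measureReal_iUnion_fintype_le _
    _ ≤ Fintype.card κ • (|c| * t ^ (-g)) := by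
        refine Finset.sum_le_card_nsmul _ _ _ fun k _ => (h i k t ht).trans ?_
        gcongr
        exacts [le_abs_self c, hgγ k]
    _ = Fintype.card κ * |c| * t ^ (-g) := by rw [nsmul_eq_mul, mul_assoc]

end Moments

namespace SimilitudeSystem

variable {d N : ℕ} [NeZero N] {S : SimilitudeSystem d N} {Ω : Type*} [MeasurableSpace Ω]
  {P : Measure Ω} {θ : Ω → Address N → S.IFix → S.IFix → ℝ}

theorem measureReal_le_card_largeCells_le (hindep : iIndepFun (fun η ω => θ ω η) P) {t r : ℝ}
    (hr : ∀ η, P.real {ω | ∃ i j, i ≠ j ∧ t ≤ θ ω η i j} ≤ r) (m L : ℕ) (η : Address N) :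
    P.real {ω | L ≤ (S.largeCells (fun w : List.Vector (Fin N) m => θ ω (η.extend w.1)) t).card} ≤
      (N ^ m).choose L * r ^ L := by
  have hinj : Function.Injective fun w : List.Vector (Fin N) m => η.extend w.1 := fun w w' h =>
    Subtype.ext ((Address.extend_inj_of_length_eq (w.2.trans w'.2.symm)).1 h).2
  have hle (i j) : MeasurableSet {Q : S.IFix → S.IFix → ℝ | t ≤ Q i j} :=
    measurableSet_le measurable_const (by fun_prop)
  have hA : MeasurableSet {Q : S.IFix → S.IFix → ℝ | ∃ i j, i ≠ j ∧ t ≤ Q i j} := by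
    simp only [Set.ofPred_exists]
    exact .iUnion fun i => .iUnion fun j => (MeasurableSet.const (i ≠ j)).inter (hle i j)
  have hcard := measureReal_le_card_filter_mem_le (D := Finset.univ) (r := r)
    (Y := fun (w : List.Vector (Fin N) m) ω => θ ω (η.extend w.1)) (hindep.precomp hinj) hA
    (fun w _ => hr (η.extend w.1)) L
  simpa only [largeCells, Set.mem_ofPred_eq, Finset.card_univ, card_vector, Fintype.card_fin]
    using hcard

theorem memLp_iterate_scaledRenorm_of_ne (h0 : ∀ x, S.Ψ 0 x = S.β⁻¹ • x)
    (ha : Function.Injective fun i : S.IFix => S.a i.1) {ϱ : ℝ} (hϱ : 0 < ϱ)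
    (hθ : ∀ ω η, S.IsQM (θ ω η)) (hmeas : ∀ η, Measurable fun ω => θ ω η)
    (hindep : iIndepFun (fun η ω => θ ω η) P) {C g : ℝ}
    (htail : ∀ η t, 1 ≤ t → P.real {ω | ∃ i j, i ≠ j ∧ t ≤ θ ω η i j} ≤ C * t ^ (-g))
    {p : ENNReal} (hp : p ≠ ⊤) {L : ℕ} (hL : p.toReal < g * L) {m : ℕ} {i j : S.IFix} (hij : i ≠ j)
    (hm : ∀ (M : List.Vector (Fin N) m → S.IFix → S.IFix → ℝ) (t : ℝ),
      Relation.ReflTransGen (S.LargeEdge (fun w => S.word w.1) M t) (S.a i.1) (S.a j.1) →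
        L ≤ (S.largeCells M t).card) (η : Address N) :
    MemLp (fun ω => (S.scaledRenorm ϱ)^[m] (θ ω) η i j) p P := by
  have := hindep.isProbabilityMeasure
  have hN : (0 : ℝ) < N := Nat.cast_pos.2 i.1.pos
  have hcard : (0 : ℝ) < Fintype.card S.IFix := Nat.cast_pos.2 (Fintype.card_pos_iff.2 ⟨i⟩)
  set κ : ℝ := (ϱ * (N * Fintype.card S.IFix ^ 2)) ^ m
  have hκ : 0 < κ := by positivity
  have hX : Measurable fun ω => (S.scaledRenorm ϱ)^[m] (θ ω) η i j :=
    (measurable_pi_apply j).comp <| (measurable_pi_apply i).comp <|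
      measurable_iterate_scaledRenorm h0 ha hϱ.le hθ hmeas m η
  suffices h : MemLp (fun ω => κ⁻¹ * (S.scaledRenorm ϱ)^[m] (θ ω) η i j) p P by
    simpa only [mul_inv_cancel_left₀ hκ.ne'] using h.const_mul κ
  refine memLp_of_forall_measureReal_le_rpow (C := (N ^ m).choose L * C ^ L)
    (hX.const_mul κ⁻¹).aestronglyMeasurable hp hL fun t ht => ?_
  have ht0 : 0 < t := zero_lt_one.trans_le ht
  have hsub : {ω | t ≤ ‖κ⁻¹ * (S.scaledRenorm ϱ)^[m] (θ ω) η i j‖} ⊆ {ω | L ≤ (S.largeCells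
      (fun w : List.Vector (Fin N) m => θ ω (η.extend w.1)) t).card} := fun ω hω => by
    have hnn := (isQM_iterate_scaledRenorm h0 ha hϱ.le (hθ ω) m η).2 i j hij
    rw [Set.mem_ofPred_eq, Real.norm_of_nonneg (mul_nonneg (inv_nonneg.2 hκ.le) hnn),
      le_inv_mul_iff₀ hκ] at hω
    exact hm _ t (reflTransGen_largeEdge_iterate_of_le h0 ha hϱ (hθ ω) ht0 m hij hω)
  calc P.real {ω | t ≤ ‖κ⁻¹ * (S.scaledRenorm ϱ)^[m] (θ ω) η i j‖} ≤ _ :=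
        measureReal_mono hsub (measure_ne_top _ _)
    _ ≤ (N ^ m).choose L * (C * t ^ (-g)) ^ L :=
        measureReal_le_card_largeCells_le hindep (fun η' => htail η' t ht) m L η
    _ = (N ^ m).choose L * C ^ L * t ^ (-(g * L)) := by
        rw [mul_pow, ← Real.rpow_mul_natCast ht0.le, neg_mul, mul_assoc]

end SimilitudeSystem

open SimilitudeSystem in
theorem proposition6p6_general {d N : ℕ} [NeZero N] {S : SimilitudeSystem d N}
    (h0 : ∀ x, S.Ψ 0 x = S.β⁻¹ • x) (ha : Function.Injective fun i : S.IFix => S.a i.1)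
    {ϱ : ℝ} (hϱ : 0 < ϱ) {Ω : Type*} [MeasurableSpace Ω] {P : Measure Ω}
    {θ : Ω → Address N → S.IFix → S.IFix → ℝ} (hθ : ∀ ω η, S.IsQM (θ ω η))
    (hmeas : ∀ η, Measurable fun ω => θ ω η) (hindep : iIndepFun (fun η ω => θ ω η) P)
    {c : ℝ} {γ : S.IFix → S.IFix → ℝ} (hγ : ∀ i j, i ≠ j → 0 < γ i j)
    (htail : ∀ i j, i ≠ j → ∀ (η : Address N) (s : ℝ), 1 ≤ s →
      P.real {ω | s ≤ θ ω η i j} ≤ c * s ^ (-γ i j))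
    {p : ENNReal} (hp : p ≠ ⊤) :
    ∀ᶠ m in atTop, ∀ (i j : S.IFix) (η : Address N),
      MemLp (fun ω => (S.scaledRenorm ϱ)^[m] (θ ω) η i j) p P := by
  obtain ⟨g, hg, C, hC⟩ := exists_forall_measureReal_exists_le_rpow (P := P)
    (X := fun η (e : {e : S.IFix × S.IFix // e.1 ≠ e.2}) ω => θ ω η e.1.1 e.1.2)
    (fun e => hγ _ _ e.2) fun η e t ht => htail _ _ e.2 η t ht
  simp only [Subtype.exists, Prod.exists, exists_prop] at hC
  obtain ⟨L, hL⟩ := exists_nat_gt (p.toReal / g)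
  filter_upwards [eventually_forall_le_card_largeCells ha L] with m hm
  have hoff {i j} (hij : i ≠ j) (η : Address N) :
      MemLp (fun ω => (S.scaledRenorm ϱ)^[m] (θ ω) η i j) p P :=
    memLp_iterate_scaledRenorm_of_ne h0 ha hϱ hθ hmeas hindep hC hp ((div_lt_iff₀' hg).1 hL) hij
      (fun M t => hm M t i j hij) η
  intro i j η
  obtain rfl | hij := eq_or_ne i j
  · simp_rw [fun ω => (isQM_iterate_scaledRenorm h0 ha hϱ.le (hθ ω) m η).1.apply_self i]
    exact (memLp_finsetSum _ fun j hj => hoff (Finset.ne_of_mem_erase hj).symm η).neg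
  · exact hoff hij η

theorem proposition6p6 {d N : ℕ} [NeZero N] (S : SimilitudeSystem d N)
    (F : Set (EuclideanSpace ℝ (Fin d))) (hF : IsUFRFractal S F)
    -- the eigenform `Q₀` and the factor `ϱ` that normalises the renormalisation map
    (Q₀ : S.IFix → S.IFix → ℝ) (hQ₀ : S.IsIntQM Q₀) (ϱ : ℝ) (hϱ : 0 < ϱ)
    (heig : S.renormConst Q₀ = ϱ⁻¹ • Q₀)
    -- the random conductances
    {Ω : Type*} [MeasurableSpace Ω] (P : Measure Ω) [IsProbabilityMeasure P]
    (θ : Ω → Address N → S.IFix → S.IFix → ℝ) (hθ : S.IsRandomConductance P Q₀ θ)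
    -- polynomial decay at infinity
    (c : ℝ) (hc : 0 < c) (γ : S.IFix → S.IFix → ℝ) (hγ : ∀ i j, i ≠ j → 0 < γ i j)
    (htail : ∀ i j, i ≠ j → ∀ (η : Address N) (s : ℝ), 1 ≤ s →
      P.real {ω | s ≤ θ ω η i j} ≤ c * s ^ (-γ i j)) :
    ((∃ n₀ : ℕ, 1 ≤ n₀ ∧ ∀ x ∈ S.V₀, ∀ y ∈ S.V₀, x ≠ y → 2 ≤ S.h n₀ x y) →
        S.HasFiniteSecondMoments P ϱ θ) ∧
      (IsNestedFractal S F → S.HasFiniteSecondMoments P ϱ θ) := by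
  obtain ⟨W, hne, -, hopen, hdisj, hsub⟩ := hF.open_set_condition
  obtain ⟨m, hm, hm1⟩ := ((proposition6p6_general hF.Ψ_zero
    ((S.a_injective hne hopen hdisj hsub).comp Subtype.val_injective) hϱ hθ.mem hθ.measurable
    hθ.indep hγ htail (p := 2) ENNReal.ofNat_ne_top).and (eventually_ge_atTop 1)).exists
  exact ⟨fun _ => ⟨m, hm1, hm⟩, fun _ => ⟨m, hm1, hm⟩⟩
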